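/- Let $d>0$, $\lambda>0$, and let $\Phi$ be a homogeneous Poisson point process of intensity $\lambda$ in $\mathbb R^2$ (the locations of the RISs). Put $x_s=(-d,0)$ and $x_d=(d,0)$ (source and destination), and let $$\Upsilon_{\rm opt}=\min_{X\in\Phi}\|x_s-X\|\,\|X-x_d\|.$$ For $m<1$ let $K(m)=\int_0^{\pi/2}\frac{d\theta}{\sqrt{1-m\sin^2\theta}}$ and, for $m\le 1$, let $E(m)=\int_0^{\pi/2}\sqrt{1-m\sin^2\theta}\,d\theta$ be the complete elliptic integrals of the first and second kind with parameter $m$. Then the minimum is almost surely attained, $\Upsilon_{\rm opt}$ is a random variable, and its cumulative distribution function satisfies, for all $\gamma\in\mathbb R$, $$F(\gamma)=1-\exp\bigl(-\lambda\,\mathrm{area}\{x\in\mathbb R^2:\|x-x_s\|\,\|x-x_d\|\le\gamma\}\bigr);$$ explicitly, $$F(\gamma)=\begin{cases}0,&\gamma<0,\\ 1-\exp\Bigl(-\frac{2\lambda}{d^2}\bigl(d^4E(\tfrac{\gamma^2}{d^4})+(\gamma^2-d^4)K(\tfrac{\gamma^2}{d^4})\bigr)\Bigr),&0\le\gamma<d^2,\\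 1-\exp\bigl(-2\lambda\gamma E(\tfrac{d^4}{\gamma^2})\bigr),&\gamma\ge d^2.\end{cases}$$ The law of $\Upsilon_{\rm opt}$ is absolutely continuous with respect to Lebesgue measure, with probability density function $$f(\gamma)=\begin{cases}0,&\gamma<0,\\ \frac{2\lambda\gamma}{d^2}\exp\Bigl(-\frac{2\lambda}{d^2}\bigl(d^4E(\tfrac{\gamma^2}{d^4})+(\gamma^2-d^4)K(\tfrac{\gamma^2}{d^4})\bigr)\Bigr)K(\tfrac{\gamma^2}{d^4}),&0\le\gamma<d^2,\\ 2\lambda\exp\bigl(-2\lambda\gamma E(\tfrac{d^4}{\gamma^2})\bigr)K(\tfrac{d^4}{\gamma^2}),&\gamma>d^2\end{cases}$$ (the value at $\gamma=d^2$, where $K(1)$ diverges, is immaterial), and $F'(\gamma)=f(\gamma)$ for every $\gamma\ne d^2$. -/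

import Mathlib

open MeasureTheory ProbabilityTheory
open scoped NNReal ENNReal

/-- The Euclidean plane, with its Euclidean norm and Lebesgue measure. -/
abbrev Plane : Type := EuclideanSpace ℝ (Fin 2)

/-- `IsPoissonProcess P Φ lam` : the random set of points `Φ` is a homogeneous Poisson point process
of intensity `lam` in the plane under the probability measure `P`. Every realization is locally
finite (hence countable), the number of points in a bounded Borel set is a Poisson random variable
whose mean is `lam` times the area, and the numbers of points in pairwise disjoint bounded Borel
sets are independent. -/
structure IsPoissonProcess {Ω : Type*} [MeasurableSpace Ω] (P : Measure Ω)
    (Φ : Ω → Set Plane) (lam : ℝ≥0) : Prop where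
  locallyFinite : ∀ (ω : Ω) (B : Set Plane), Bornology.IsBounded B → (Φ ω ∩ B).Finite
  measurable_count : ∀ B : Set Plane, Bornology.IsBounded B → MeasurableSet B →
    Measurable (fun ω => (Φ ω ∩ B).ncard)
  map_count : ∀ B : Set Plane, Bornology.IsBounded B → MeasurableSet B →
    P.map (fun ω => (Φ ω ∩ B).ncard) = poissonMeasure (lam * (volume B).toNNReal)
  indep_count : ∀ (n : ℕ) (B : Fin n → Set Plane),
    (∀ i, Bornology.IsBounded (B i)) → (∀ i, MeasurableSet (B i)) →
    (∀ i j, i ≠ j → Disjoint (B i) (B j)) →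
    iIndepFun (fun (i : Fin n) (ω : Ω) => (Φ ω ∩ B i).ncard) P

/-- The position `(-d, 0)` of the source. -/
noncomputable def source (d : ℝ) : Plane := !₂[-d, 0]

/-- The position `(d, 0)` of the destination. -/
noncomputable def destination (d : ℝ) : Plane := !₂[d, 0]

/-- The product of the distances from `x` to the source and to the destination. -/
noncomputable def distProduct (d : ℝ) (x : Plane) : ℝ :=
  ‖source d - x‖ * ‖x - destination d‖

/-- The least value of `distProduct d` over the set of points `φ`. -/
noncomputable def minDistProduct (d : ℝ) (φ : Set Plane) : ℝ :=
  sInf (distProduct d '' φ)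

/-- The complete elliptic integral of the first kind, as a function of the parameter `m = k ^ 2`. -/
noncomputable def ellipticK (m : ℝ) : ℝ :=
  ∫ θ in (0 : ℝ)..(Real.pi / 2), 1 / √(1 - m * Real.sin θ ^ 2)

/-- The complete elliptic integral of the second kind, as a function of the parameter
`m = k ^ 2`. -/
noncomputable def ellipticE (m : ℝ) : ℝ :=
  ∫ θ in (0 : ℝ)..(Real.pi / 2), √(1 - m * Real.sin θ ^ 2)

/-- The claimed distribution function of the minimal distance product. -/
noncomputable def optCDF (lam d γ : ℝ) : ℝ :=
  if γ < 0 then 0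
  else if γ < d ^ 2 then
    1 - Real.exp (-(2 * lam / d ^ 2) *
      (d ^ 4 * ellipticE (γ ^ 2 / d ^ 4) + (γ ^ 2 - d ^ 4) * ellipticK (γ ^ 2 / d ^ 4)))
  else 1 - Real.exp (-(2 * lam * γ * ellipticE (d ^ 4 / γ ^ 2)))

/-- The claimed probability density of the minimal distance product. (At the single point
`γ = d ^ 2` the integral `ellipticK 1` diverges, and the value there is irrelevant.) -/
noncomputable def optPDF (lam d γ : ℝ) : ℝ :=
  if γ < 0 then 0
  else if γ < d ^ 2 then
    2 * lam * γ / d ^ 2 * Real.exp (-(2 * lam / d ^ 2) *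
      (d ^ 4 * ellipticE (γ ^ 2 / d ^ 4) + (γ ^ 2 - d ^ 4) * ellipticK (γ ^ 2 / d ^ 4))) *
      ellipticK (γ ^ 2 / d ^ 4)
  else 2 * lam * Real.exp (-(2 * lam * γ * ellipticE (d ^ 4 / γ ^ 2))) *
      ellipticK (d ^ 4 / γ ^ 2)

/-! For `0 ≤ γ`, on nonempty configurations, the minimum exceeds `γ` exactly when no point falls in
the Cassini region `{x | distProduct d x ≤ γ}`. This region is bounded, so the Poisson void
probability gives `exp (-lam * area)`; the empty configuration has probability zero.

In polar coordinates the region is a band in `r ^ 2`, centred at `d ^ 2 * cos 2θ` and truncated at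
zero. Pairing `φ = 2θ` with `φ + π` cancels the truncations, and the area becomes `2 ∫ √(γ ^ 2 - d ^
4 sin ^ 2 φ)` over `[0, π/2]` (`volume_real_setOf_distProduct_le`). Beyond `d ^ 2`, factoring out
`γ` yields `E`. Below it, `sin φ = k sin θ` with `k = γ / d ^ 2` yields `ellipticB`, a combination
of `E` and `K`.

The area is differentiated directly above `d ^ 2`, and below it through the equation `2B + 2mB' = K`
(`two_mul_ellipticB_add`). The CDF is continuous and monotone, so the exceptional point `d ^ 2`
carries no mass and the derivative is a density. -/

/-! ### Deterministic properties of the distance product -/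

theorem continuous_distProduct (d : ℝ) : Continuous (distProduct d) := by
  unfold distProduct; fun_prop

theorem distProduct_nonneg (d : ℝ) (x : Plane) : 0 ≤ distProduct d x := by
  unfold distProduct; positivity

theorem isBounded_setOf_distProduct_le (d γ : ℝ) :
    Bornology.IsBounded {x : Plane | distProduct d x ≤ γ} := by
  refine (Metric.isBounded_closedBall (x := (0 : Plane))
    (r := max (‖source d‖ + 1) (‖destination d‖ + γ))).subset fun x hx => ?_
  rw [mem_closedBall_zero_iff]
  simp only [Set.mem_ofPred_eq, distProduct] at hx
  have h1 : ‖x‖ ≤ ‖source d‖ + ‖source d - x‖ := by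
    have := norm_sub_le (source d) (source d - x); simpa using this
  have h2 : ‖x‖ ≤ ‖destination d‖ + ‖x - destination d‖ := by
    have := norm_add_le (destination d) (x - destination d); simpa using this
  -- If the distance to the source exceeds 1, the other factor is at most `γ`.
  by_cases h : ‖source d - x‖ ≤ 1
  · exact le_max_of_le_left (by linarith)
  · push Not at h
    refine le_max_of_le_right ?_
    nlinarith [norm_nonneg (x - destination d)]

theorem measurableSet_setOf_distProduct_le (d γ : ℝ) :
    MeasurableSet {x : Plane | distProduct d x ≤ γ} :=
  measurableSet_le (continuous_distProduct d).measurable measurable_const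

theorem minDistProduct_nonneg (d : ℝ) (φ : Set Plane) : 0 ≤ minDistProduct d φ := by
  refine Real.sInf_nonneg ?_
  rintro _ ⟨x, -, rfl⟩
  exact distProduct_nonneg d x

/-- A nonempty locally finite set of points contains a point of least distance product. -/
theorem isLeast_minDistProduct (d : ℝ) {φ : Set Plane} (hne : φ.Nonempty)
    (hfin : ∀ B : Set Plane, Bornology.IsBounded B → (φ ∩ B).Finite) :
    IsLeast (distProduct d '' φ) (minDistProduct d φ) := by
  obtain ⟨x₀, hx₀⟩ := hne
  -- Only the finitely many points doing at least as well as `x₀` compete.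
  obtain ⟨x, ⟨hxφ, hx⟩, hmin⟩ := Set.exists_min_image _ (distProduct d)
    (hfin _ (isBounded_setOf_distProduct_le d (distProduct d x₀))) ⟨x₀, hx₀, le_refl (distProduct d x₀)⟩
  have hl : IsLeast (distProduct d '' φ) (distProduct d x) := by
    refine ⟨Set.mem_image_of_mem _ hxφ, ?_⟩
    rintro _ ⟨y, hy, rfl⟩
    by_cases h : distProduct d y ≤ distProduct d x₀
    · exact hmin y ⟨hy, h⟩
    · exact le_trans hx (not_le.1 h).le
  rw [minDistProduct, hl.csInf_eq]
  exact hl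

theorem setOf_eq_empty_eq_iInter {Ω : Type*} (Φ : Ω → Set Plane) :
    {ω | Φ ω = ∅} = ⋂ n : ℕ, {ω | Φ ω ∩ Metric.ball 0 n = ∅} := by
  ext ω
  simp only [Set.mem_ofPred_eq, Set.mem_iInter, ← Set.disjoint_iff_inter_eq_empty]
  rw [← Set.disjoint_iUnion_right, Metric.iUnion_ball_nat, Set.disjoint_univ]

/-! ### Void probabilities and the law of the minimum -/

namespace IsPoissonProcess

variable {Ω : Type*} [MeasurableSpace Ω] {P : Measure Ω} {Φ : Ω → Set Plane} {lam : ℝ≥0}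

theorem measurableSet_inter_eq_empty (hΦ : IsPoissonProcess P Φ lam) {B : Set Plane}
    (hb : Bornology.IsBounded B) (hB : MeasurableSet B) :
    MeasurableSet {ω | Φ ω ∩ B = ∅} := by
  have h : {ω | Φ ω ∩ B = ∅} = (fun ω => (Φ ω ∩ B).ncard) ⁻¹' {0} := by
    ext ω
    simp [Set.ncard_eq_zero (hΦ.locallyFinite ω B hb)]
  rw [h]
  exact hΦ.measurable_count B hb hB (measurableSet_singleton 0)

/-- The void probabilities of a Poisson process. -/
theorem measure_inter_eq_empty (hΦ : IsPoissonProcess P Φ lam) {B : Set Plane}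
    (hb : Bornology.IsBounded B) (hB : MeasurableSet B) :
    P {ω | Φ ω ∩ B = ∅} = ENNReal.ofReal (Real.exp (-(lam * volume.real B))) := by
  have h : {ω | Φ ω ∩ B = ∅} = (fun ω => (Φ ω ∩ B).ncard) ⁻¹' {0} := by
    ext ω
    simp [Set.ncard_eq_zero (hΦ.locallyFinite ω B hb)]
  rw [h, ← Measure.map_apply (hΦ.measurable_count B hb hB) (measurableSet_singleton 0),
    hΦ.map_count B hb hB, poissonMeasure_singleton]
  simp [Measure.real, ENNReal.coe_toNNReal_eq_toReal]

theorem measurableSet_eq_empty (hΦ : IsPoissonProcess P Φ lam) : MeasurableSet {ω | Φ ω = ∅} := by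
  rw [setOf_eq_empty_eq_iInter]
  exact MeasurableSet.iInter fun n =>
    hΦ.measurableSet_inter_eq_empty Metric.isBounded_ball measurableSet_ball

theorem ae_nonempty (hΦ : IsPoissonProcess P Φ lam) (hlam : 0 < lam) :
    ∀ᵐ ω ∂P, (Φ ω).Nonempty := by
  have h0 : P {ω | Φ ω = ∅} = 0 := by
    have hle : ∀ n : ℕ, P {ω | Φ ω = ∅} ≤
        ENNReal.ofReal (Real.exp (-(lam * volume.real (Metric.ball (0 : Plane) n)))) := fun n => by
      rw [← hΦ.measure_inter_eq_empty Metric.isBounded_ball measurableSet_ball]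
      refine measure_mono fun ω hω => ?_
      simp only [Set.mem_ofPred_eq] at hω ⊢
      simp [hω]
    refine le_antisymm (ge_of_tendsto' (x := Filter.atTop) ?_ hle) bot_le
    have hvol : ∀ n : ℕ, volume.real (Metric.ball (0 : Plane) n) = (n : ℝ) ^ 2 * Real.pi := fun n => by
      rw [Measure.real, EuclideanSpace.volume_ball_fin_two]
      simp [Real.pi_nonneg]
    simp_rw [hvol]
    rw [← ENNReal.ofReal_zero]
    refine ENNReal.tendsto_ofReal (Real.tendsto_exp_neg_atTop_nhds_zero.comp ?_)
    refine Filter.Tendsto.const_mul_atTop (by exact_mod_cast hlam) ?_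
    refine Filter.Tendsto.atTop_mul_const Real.pi_pos ?_
    exact (Filter.tendsto_pow_atTop two_ne_zero).comp tendsto_natCast_atTop_atTop
  filter_upwards [measure_eq_zero_iff_ae_notMem.1 h0] with ω hω
  exact Set.nonempty_iff_ne_empty.2 hω

/-- The empty configuration appears separately because `sInf ∅ = 0 ≤ γ`. -/
theorem setOf_minDistProduct_le (hΦ : IsPoissonProcess P Φ lam) (d : ℝ) {γ : ℝ} (hγ : 0 ≤ γ) :
    {ω | minDistProduct d (Φ ω) ≤ γ} =
      {ω | Φ ω = ∅} ∪ {ω | Φ ω ∩ {x | distProduct d x ≤ γ} = ∅}ᶜ := by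
  ext ω
  simp only [Set.mem_ofPred_eq, Set.mem_union, Set.mem_compl_iff]
  rcases Set.eq_empty_or_nonempty (Φ ω) with h | h
  · simp [h, minDistProduct, hγ]
  · have hl := isLeast_minDistProduct d h (hΦ.locallyFinite ω)
    simp only [h.ne_empty, false_or, ← ne_eq, ← Set.nonempty_iff_ne_empty]
    constructor
    · intro hle
      obtain ⟨x, hx, hxe⟩ := hl.1
      exact ⟨x, hx, by simpa [hxe] using hle⟩
    · rintro ⟨x, hx, hxγ⟩
      exact (hl.2 (Set.mem_image_of_mem _ hx)).trans hxγ

theorem measurable_minDistProduct (hΦ : IsPoissonProcess P Φ lam) (d : ℝ) :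
    Measurable (fun ω => minDistProduct d (Φ ω)) := by
  refine measurable_of_Iic fun γ => ?_
  rcases lt_or_ge γ 0 with hγ | hγ
  · convert MeasurableSet.empty
    ext ω
    simpa using hγ.trans_le (minDistProduct_nonneg d (Φ ω))
  · change MeasurableSet {ω | minDistProduct d (Φ ω) ≤ γ}
    rw [hΦ.setOf_minDistProduct_le d hγ]
    exact hΦ.measurableSet_eq_empty.union (hΦ.measurableSet_inter_eq_empty
      (isBounded_setOf_distProduct_le d γ) (measurableSet_setOf_distProduct_le d γ)).compl

theorem cdf_map_minDistProduct [IsProbabilityMeasure P] (hΦ : IsPoissonProcess P Φ lam)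
    (hlam : 0 < lam) (d γ : ℝ) :
    cdf (P.map (fun ω => minDistProduct d (Φ ω))) γ
      = 1 - Real.exp (-(lam * volume.real {x : Plane | distProduct d x ≤ γ})) := by
  have hm := hΦ.measurable_minDistProduct d
  have := Measure.isProbabilityMeasure_map (μ := P) hm.aemeasurable
  rw [cdf_eq_real, Measure.real, Measure.map_apply hm measurableSet_Iic]
  change (P {ω | minDistProduct d (Φ ω) ≤ γ}).toReal = _
  rcases lt_or_ge γ 0 with hγ | hγ
  · have h1 : {ω | minDistProduct d (Φ ω) ≤ γ} = ∅ := by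
      ext ω
      simpa using hγ.trans_le (minDistProduct_nonneg d (Φ ω))
    have h2 : {x : Plane | distProduct d x ≤ γ} = ∅ := by
      ext x
      simpa using hγ.trans_le (distProduct_nonneg d x)
    simp [h1, h2]
  · have hae : {ω | minDistProduct d (Φ ω) ≤ γ} =ᵐ[P]
        ({ω | Φ ω ∩ {x | distProduct d x ≤ γ} = ∅}ᶜ : Set Ω) := by
      rw [hΦ.setOf_minDistProduct_le d hγ, ae_eq_set]
      refine ⟨measure_mono_null ?_ (hΦ.ae_nonempty hlam),
        measure_mono_null (t := ∅) (fun ω hω => absurd (.inr hω.1) hω.2) measure_empty⟩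
      rintro ω ⟨h | h, h'⟩
      · simpa [Set.nonempty_iff_ne_empty] using h
      · exact absurd h h'
    have hb := isBounded_setOf_distProduct_le d γ
    have hB := measurableSet_setOf_distProduct_le d γ
    rw [measure_congr hae, ← Measure.real,
      probReal_compl_eq_one_sub (hΦ.measurableSet_inter_eq_empty hb hB), Measure.real,
      hΦ.measure_inter_eq_empty hb hB, ENNReal.toReal_ofReal (Real.exp_nonneg _)]

end IsPoissonProcess

/-! ### From derivative to density -/

/-- A continuous distribution function that is differentiable off one point has the derivative as a
density. -/
theorem StieltjesFunction.measure_eq_withDensity_of_hasDerivAt (F : StieltjesFunction ℝ)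
    {f : ℝ → ℝ} {c : ℝ} (hF : Continuous F) (hderiv : ∀ x, x ≠ c → HasDerivAt F (f x) x) :
    F.measure = volume.withDensity (fun x => ENNReal.ofReal (f x)) := by
  have hnonneg : ∀ x, x ≠ c → 0 ≤ f x := fun x hx => by
    rw [← (hderiv x hx).deriv]; exact F.mono.deriv_nonneg
  have key : ∀ a b, a ≤ b → (b ≤ c ∨ c ≤ a) →
      ∫⁻ x in Set.Ioc a b, ENNReal.ofReal (f x) = ENNReal.ofReal (F b - F a) := by
    intro a b hab hc
    have hne : ∀ x ∈ Set.Ioo a b, x ≠ c := by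
      rintro x ⟨h1, h2⟩ rfl
      rcases hc with hc | hc <;> linarith
    -- Nonnegativity gives integrability even if `f` is unbounded near `c`, which can only be an
    -- endpoint here.
    have hint : IntegrableOn f (Set.Ioc a b) :=
      intervalIntegral.integrableOn_deriv_of_nonneg hF.continuousOn
        (fun x hx => hderiv x (hne x hx)) (fun x hx => hnonneg x (hne x hx))
    rw [← ofReal_integral_eq_lintegral_ofReal hint, ← intervalIntegral.integral_of_le hab,
      intervalIntegral.integral_eq_sub_of_hasDerivAt_of_le hab hF.continuousOn
        (fun x hx => hderiv x (hne x hx)) ((intervalIntegrable_iff_integrableOn_Ioc_of_le hab).2 hint)]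
    refine ae_restrict_of_ae ?_
    filter_upwards [Measure.ae_ne volume c] with x hx using hnonneg x hx
  refine Measure.ext_of_Ioc _ _ fun a b hab => ?_
  rw [F.measure_Ioc, withDensity_apply _ measurableSet_Ioc]
  rcases le_or_gt b c with h | h
  · exact (key a b hab.le (.inl h)).symm
  rcases le_or_gt c a with h' | h'
  · exact (key a b hab.le (.inr h')).symm
  · rw [← Set.Ioc_union_Ioc_eq_Ioc h'.le h.le, lintegral_union measurableSet_Ioc
      (Set.Ioc_disjoint_Ioc_of_le le_rfl), key a c h'.le (.inl le_rfl), key c b h.le (.inr le_rfl),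
      ← ENNReal.ofReal_add (sub_nonneg.2 (F.mono h'.le)) (sub_nonneg.2 (F.mono h.le))]
    congr 1; ring

/-! ### Area of the Cassini region in polar coordinates -/

theorem measurePreserving_toLp_finTwo :
    MeasurePreserving (fun p : ℝ × ℝ => (!₂[p.1, p.2] : Plane)) :=
  (PiLp.volume_preserving_toLp (Fin 2)).comp (volume_preserving_finTwoArrow ℝ).symm

theorem distProduct_sq (d x y : ℝ) :
    distProduct d !₂[x, y] ^ 2 = ((x + d) ^ 2 + y ^ 2) * ((x - d) ^ 2 + y ^ 2) := by
  simp only [distProduct, source, destination, mul_pow, EuclideanSpace.norm_sq_eq, Fin.sum_univ_two]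
  simp [-mul_eq_mul_right_iff, -mul_eq_mul_left_iff]
  ring

/-- The squared product is `r ^ 4 - 2 d ^ 2 r ^ 2 cos 2θ + d ^ 4`; complete the square in `r ^ 2`.
-/
theorem distProduct_polar_le_iff (d r θ : ℝ) {γ : ℝ} (hγ : 0 ≤ γ) :
    distProduct d !₂[r * Real.cos θ, r * Real.sin θ] ≤ γ ↔
      (r ^ 2 - d ^ 2 * Real.cos (2 * θ)) ^ 2 ≤ γ ^ 2 - d ^ 4 * Real.sin (2 * θ) ^ 2 := by
  rw [← pow_le_pow_iff_left₀ (distProduct_nonneg _ _) hγ two_ne_zero, distProduct_sq,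
    Real.sin_two_mul, Real.cos_two_mul]
  have h := Real.sin_sq_add_cos_sq θ
  have hs : Real.sin θ ^ 2 = 1 - Real.cos θ ^ 2 := by linarith
  rw [← sub_nonneg, ← sub_nonneg (b := (_ : ℝ) ^ 2)]
  have e : γ ^ 2 - ((r * Real.cos θ + d) ^ 2 + (r * Real.sin θ) ^ 2) *
      ((r * Real.cos θ - d) ^ 2 + (r * Real.sin θ) ^ 2) =
      γ ^ 2 - d ^ 4 * (2 * Real.sin θ * Real.cos θ) ^ 2 -
        (r ^ 2 - d ^ 2 * (2 * Real.cos θ ^ 2 - 1)) ^ 2 := by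
    simp only [mul_pow, hs]
    ring
  rw [e]

/-- The condition confines `r ^ 2` to `[c - √v, c + √v]`, and `r dr` is half of `d(r ^ 2)`. For `v <
0` both sides vanish, as `√v = 0`. -/
theorem lintegral_radial (c v : ℝ) :
    ∫⁻ r in Set.Ioi (0 : ℝ), ENNReal.ofReal r * {r : ℝ | (r ^ 2 - c) ^ 2 ≤ v}.indicator 1 r =
      ENNReal.ofReal ((max (c + √v) 0 - max (c - √v) 0) / 2) := by
  rcases lt_or_ge v 0 with hv | hv
  · have h : {r : ℝ | (r ^ 2 - c) ^ 2 ≤ v} = ∅ := by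
      ext r
      simpa using hv.trans_le (sq_nonneg _)
    simp [h, Real.sqrt_eq_zero_of_nonpos hv.le]
  · have hle : √(c - √v) ≤ √(c + √v) := Real.sqrt_le_sqrt (by linarith [Real.sqrt_nonneg v])
    have h1 : ∫⁻ r in Set.Ioi (0 : ℝ),
        ENNReal.ofReal r * {r : ℝ | (r ^ 2 - c) ^ 2 ≤ v}.indicator 1 r =
        ∫⁻ r in Set.Ioi (0 : ℝ),
          (Set.Icc √(c - √v) √(c + √v)).indicator (fun r => ENNReal.ofReal r) r := by
      refine setLIntegral_congr_fun measurableSet_Ioi fun r (hr : 0 < r) => ?_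
      have hiff : (r ^ 2 - c) ^ 2 ≤ v ↔ r ∈ Set.Icc √(c - √v) √(c + √v) := by
        rw [Set.mem_Icc, Real.sqrt_le_left hr.le, Real.le_sqrt' hr, ← Real.sqrt_le_sqrt_iff hv,
          Real.sqrt_sq_eq_abs, abs_le]
        constructor <;> rintro ⟨h1, h2⟩ <;> constructor <;> linarith
      by_cases h : (r ^ 2 - c) ^ 2 ≤ v
      · rw [Set.indicator_of_mem (show r ∈ {r : ℝ | (r ^ 2 - c) ^ 2 ≤ v} from h),
          Set.indicator_of_mem (hiff.1 h)]
        simp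
      · rw [Set.indicator_of_notMem (show r ∉ {r : ℝ | (r ^ 2 - c) ^ 2 ≤ v} from h),
          Set.indicator_of_notMem (fun h' => h (hiff.2 h'))]
        simp
    have h2 : (Set.Icc √(c - √v) √(c + √v) ∩ Set.Ioi 0 : Set ℝ) =ᵐ[volume]
        Set.Ioc √(c - √v) √(c + √v) := by
      filter_upwards [Measure.ae_ne volume √(c - √v)] with r hr
      refine propext ⟨fun h => ⟨lt_of_le_of_ne h.1.1 hr.symm, h.1.2⟩,
        fun h => ⟨⟨h.1.le, h.2⟩, (Real.sqrt_nonneg _).trans_lt h.1⟩⟩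
    -- The truncations at zero come from `Real.sq_sqrt'`: `√x ^ 2 = max x 0`.
    rw [h1, lintegral_indicator measurableSet_Icc, Measure.restrict_restrict measurableSet_Icc,
      setLIntegral_congr h2, ← ofReal_integral_eq_lintegral_ofReal, ← intervalIntegral.integral_of_le hle,
      integral_id, Real.sq_sqrt', Real.sq_sqrt']
    · exact (continuous_id.integrableOn_Icc).mono_set Set.Ioc_subset_Icc_self
    · filter_upwards [ae_restrict_mem measurableSet_Ioc] with r hr
      exact (Real.sqrt_nonneg _).trans hr.1.le

/-- The square of the radial extent of the Cassini oval in the direction of angle `φ / 2`. -/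
noncomputable def cassiniExtent (d γ φ : ℝ) : ℝ :=
  max (d ^ 2 * Real.cos φ + √(γ ^ 2 - d ^ 4 * Real.sin φ ^ 2)) 0 -
    max (d ^ 2 * Real.cos φ - √(γ ^ 2 - d ^ 4 * Real.sin φ ^ 2)) 0

theorem continuous_cassiniExtent (d γ : ℝ) : Continuous (cassiniExtent d γ) := by
  unfold cassiniExtent; fun_prop

theorem cassiniExtent_nonneg (d γ φ : ℝ) : 0 ≤ cassiniExtent d γ φ := by
  have := Real.sqrt_nonneg (γ ^ 2 - d ^ 4 * Real.sin φ ^ 2)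
  exact sub_nonneg.2 (max_le_max_right _ (by linarith))

/-- The shift negates the cosine, so the truncated terms pair up through `max x 0 - max (-x) 0 = x`.
-/
theorem cassiniExtent_add_pi (d γ φ : ℝ) :
    cassiniExtent d γ φ + cassiniExtent d γ (φ + Real.pi) =
      2 * √(γ ^ 2 - d ^ 4 * Real.sin φ ^ 2) := by
  simp only [cassiniExtent, Real.cos_add_pi, Real.sin_add_pi, neg_sq]
  set u := √(γ ^ 2 - d ^ 4 * Real.sin φ ^ 2)
  set a := d ^ 2 * Real.cos φ
  have h1 := max_zero_sub_eq_self (a + u)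
  have h2 := max_zero_sub_eq_self (u - a)
  rw [show d ^ 2 * -Real.cos φ = -a by simp [a], show -a + u = u - a by ring,
    show -a - u = -(a + u) by ring, show a - u = -(u - a) by ring]
  linarith

theorem volume_setOf_distProduct_le_eq_ofReal (d : ℝ) {γ : ℝ} (hγ : 0 ≤ γ) :
    volume {x : Plane | distProduct d x ≤ γ} =
      ENNReal.ofReal (∫ θ in (-Real.pi)..Real.pi, cassiniExtent d γ (2 * θ) / 2) := by
  have hS := measurableSet_setOf_distProduct_le d γ
  have hpi : -Real.pi ≤ Real.pi := by linarith [Real.pi_pos]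
  rw [← measurePreserving_toLp_finTwo.measure_preimage hS.nullMeasurableSet,
    ← lintegral_indicator_one (measurePreserving_toLp_finTwo.measurable hS),
    ← lintegral_comp_polarCoord_symm]
  have hcongr : ∀ p : ℝ × ℝ, ENNReal.ofReal p.1 •
      ((fun p : ℝ × ℝ => (!₂[p.1, p.2] : Plane)) ⁻¹' {x | distProduct d x ≤ γ}).indicator
        (1 : ℝ × ℝ → ℝ≥0∞) (polarCoord.symm p) =
      ENNReal.ofReal p.1 * {r : ℝ | (r ^ 2 - d ^ 2 * Real.cos (2 * p.2)) ^ 2 ≤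
        γ ^ 2 - d ^ 4 * Real.sin (2 * p.2) ^ 2}.indicator 1 p.1 := fun p => by
    have := distProduct_polar_le_iff d p.1 p.2 hγ
    rw [smul_eq_mul]
    congr 1
    by_cases h : (p.1 ^ 2 - d ^ 2 * Real.cos (2 * p.2)) ^ 2 ≤
      γ ^ 2 - d ^ 4 * Real.sin (2 * p.2) ^ 2
    · rw [Set.indicator_of_mem (show polarCoord.symm p ∈ _ from this.2 h),
        Set.indicator_of_mem (s := {r : ℝ | (r ^ 2 - d ^ 2 * Real.cos (2 * p.2)) ^ 2 ≤
          γ ^ 2 - d ^ 4 * Real.sin (2 * p.2) ^ 2}) h]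
      rfl
    · rw [Set.indicator_of_notMem (show polarCoord.symm p ∉ _ from fun h' => h (this.1 h')),
        Set.indicator_of_notMem (s := {r : ℝ | (r ^ 2 - d ^ 2 * Real.cos (2 * p.2)) ^ 2 ≤
          γ ^ 2 - d ^ 4 * Real.sin (2 * p.2) ^ 2}) h]
  simp_rw [hcongr]
  rw [polarCoord_target, Measure.volume_eq_prod, ← Measure.prod_restrict, lintegral_prod_symm]
  · simp_rw [lintegral_radial]
    rw [← ofReal_integral_eq_lintegral_ofReal, intervalIntegral.integral_of_le hpi,
      integral_Ioc_eq_integral_Ioo]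
    · rfl
    · exact (Continuous.integrableOn_Icc (by fun_prop)).mono_set Set.Ioo_subset_Icc_self
    · exact .of_forall fun θ => div_nonneg (cassiniExtent_nonneg d γ (2 * θ)) zero_le_two
  · refine Measurable.aemeasurable ?_
    refine (ENNReal.measurable_ofReal.comp measurable_fst).mul ?_
    have hm : MeasurableSet {p : ℝ × ℝ | (p.1 ^ 2 - d ^ 2 * Real.cos (2 * p.2)) ^ 2 ≤
        γ ^ 2 - d ^ 4 * Real.sin (2 * p.2) ^ 2} :=
      measurableSet_le (by fun_prop) (by fun_prop)
    exact (measurable_const (a := (1 : ℝ≥0∞))).indicator hm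

/-- The area of the region bounded by a Cassini oval. The square root is `0` where its argument is
negative, so that the formula covers ovals with one and with two components. -/
theorem volume_real_setOf_distProduct_le (d : ℝ) {γ : ℝ} (hγ : 0 ≤ γ) :
    volume.real {x : Plane | distProduct d x ≤ γ} =
      2 * ∫ φ in (0 : ℝ)..(Real.pi / 2), √(γ ^ 2 - d ^ 4 * Real.sin φ ^ 2) := by
  have hc := continuous_cassiniExtent d γ
  have hu : Continuous fun φ => √(γ ^ 2 - d ^ 4 * Real.sin φ ^ 2) := by fun_prop
  have hper : Function.Periodic (cassiniExtent d γ) (2 * Real.pi) := fun φ => by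
    simp [cassiniExtent]
  rw [Measure.real, volume_setOf_distProduct_le_eq_ofReal d hγ, ENNReal.toReal_ofReal]
  · rw [intervalIntegral.integral_div, intervalIntegral.integral_comp_mul_left _ two_ne_zero]
    -- After `φ = 2θ` the full turn in `θ` covers two periods.
    have e1 : ∫ φ in (2 * -Real.pi)..(2 * Real.pi), cassiniExtent d γ φ =
        2 * ∫ φ in (0 : ℝ)..(2 * Real.pi), cassiniExtent d γ φ := by
      rw [← intervalIntegral.integral_add_adjacent_intervals (b := 0)
        (hc.intervalIntegrable _ _) (hc.intervalIntegrable _ _), two_mul (∫ _ in _.._, _)]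
      congr 1
      have := hper.intervalIntegral_add_eq (-(2 * Real.pi)) 0
      simpa using this
    have e2 : ∫ φ in (0 : ℝ)..(2 * Real.pi), cassiniExtent d γ φ =
        2 * ∫ φ in (0 : ℝ)..Real.pi, √(γ ^ 2 - d ^ 4 * Real.sin φ ^ 2) := by
      rw [← intervalIntegral.integral_add_adjacent_intervals (b := Real.pi)
        (hc.intervalIntegrable _ _) (hc.intervalIntegrable _ _),
        ← intervalIntegral.integral_const_mul]
      have : ∫ φ in Real.pi..(2 * Real.pi), cassiniExtent d γ φ =
          ∫ φ in (0 : ℝ)..Real.pi, cassiniExtent d γ (φ + Real.pi) := by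
        rw [intervalIntegral.integral_comp_add_right]
        congr 1 <;> ring
      rw [this, ← intervalIntegral.integral_add (hc.intervalIntegrable _ _)
        (Continuous.intervalIntegrable (by fun_prop) _ _)]
      simp_rw [cassiniExtent_add_pi]
    have e3 : ∫ φ in (0 : ℝ)..Real.pi, √(γ ^ 2 - d ^ 4 * Real.sin φ ^ 2) =
        2 * ∫ φ in (0 : ℝ)..(Real.pi / 2), √(γ ^ 2 - d ^ 4 * Real.sin φ ^ 2) := by
      rw [← intervalIntegral.integral_add_adjacent_intervals (b := Real.pi / 2)
        (hu.intervalIntegrable _ _) (hu.intervalIntegrable _ _), two_mul]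
      congr 1
      have := intervalIntegral.integral_comp_sub_left (a := 0) (b := Real.pi / 2)
        (fun φ => √(γ ^ 2 - d ^ 4 * Real.sin φ ^ 2)) Real.pi
      simp only [Real.sin_pi_sub, sub_zero, sub_half] at this
      exact this.symm
    rw [e1, e2, e3, smul_eq_mul]
    ring
  · exact intervalIntegral.integral_nonneg (by linarith [Real.pi_pos]) fun θ _ =>
      div_nonneg (cassiniExtent_nonneg _ _ _) zero_le_two

/-! ### Elliptic integrals and their differential equation -/

/-- Differentiation under the integral sign for an integrand with a jointly continuous partial
derivative. -/
theorem intervalIntegral.hasDerivAt_integral_of_continuousOn {F F' : ℝ → ℝ → ℝ} {U : Set ℝ}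
    (hU : IsOpen U) {x₀ : ℝ} (hx₀ : x₀ ∈ U) (a b : ℝ) (hF : ∀ x ∈ U, Continuous (F x))
    (hderiv : ∀ x ∈ U, ∀ t, HasDerivAt (fun x => F x t) (F' x t) x)
    (hF' : ContinuousOn (Function.uncurry F') (U ×ˢ Set.univ)) :
    HasDerivAt (fun x => ∫ t in a..b, F x t) (∫ t in a..b, F' x₀ t) x₀ := by
  obtain ⟨ε, hε, hball⟩ := Metric.nhds_basis_closedBall.mem_iff.1 (hU.mem_nhds hx₀)
  obtain ⟨C, hC⟩ := ((isCompact_closedBall x₀ ε).prod (isCompact_uIcc (a := a) (b := b))).exists_bound_of_continuousOn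
    (hF'.mono (Set.prod_mono hball (Set.subset_univ _)))
  have hF'₀ : Continuous (F' x₀) := by
    rw [← continuousOn_univ]
    exact hF'.comp (f := fun t => (x₀, t)) (by fun_prop) fun t _ => ⟨hx₀, trivial⟩
  refine (intervalIntegral.hasDerivAt_integral_of_dominated_loc_of_deriv_le
    (bound := fun _ => C) (Metric.closedBall_mem_nhds x₀ hε) ?_
    ((hF x₀ hx₀).intervalIntegrable _ _) hF'₀.aestronglyMeasurable ?_ (by simp) ?_).2
  · filter_upwards [hU.mem_nhds hx₀] with x hx using (hF x hx).aestronglyMeasurable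
  · exact .of_forall fun t ht x hx => hC (x, t) ⟨hx, Set.uIoc_subset_uIcc ht⟩
  · exact .of_forall fun t _ x hx => hderiv x (hball hx) t

theorem one_sub_mul_sin_sq_pos {m : ℝ} (hm : m < 1) (θ : ℝ) : 0 < 1 - m * Real.sin θ ^ 2 := by
  have h1 := Real.sin_sq_le_one θ
  have h2 := sq_nonneg (Real.sin θ)
  rcases le_or_gt m 0 with h | h <;> nlinarith

theorem continuous_inv_sqrt_one_sub_mul_sin_sq {m : ℝ} (hm : m < 1) :
    Continuous fun θ => 1 / √(1 - m * Real.sin θ ^ 2) :=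
  continuous_const.div (by fun_prop) fun θ => (Real.sqrt_pos.2 (one_sub_mul_sin_sq_pos hm θ)).ne'

/-- The complete elliptic integral `(E - (1 - m) K) / m`. -/
noncomputable def ellipticB (m : ℝ) : ℝ :=
  ∫ θ in (0 : ℝ)..(Real.pi / 2), Real.cos θ ^ 2 / √(1 - m * Real.sin θ ^ 2)

/-- Pointwise, `m cos ^ 2 θ = (1 - m sin ^ 2 θ) - (1 - m)`. -/
theorem mul_ellipticB {m : ℝ} (hm : m < 1) :
    m * ellipticB m = ellipticE m - (1 - m) * ellipticK m := by
  rw [ellipticB, ellipticE, ellipticK, ← intervalIntegral.integral_const_mul,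
    ← intervalIntegral.integral_const_mul, ← intervalIntegral.integral_sub]
  · refine intervalIntegral.integral_congr fun θ _ => ?_
    have hpos := one_sub_mul_sin_sq_pos hm θ
    have hs := Real.sqrt_pos.2 hpos
    have hsq := Real.sq_sqrt hpos.le
    have h := Real.sin_sq_add_cos_sq θ
    field_simp
    rw [hsq]
    linear_combination m * h
  · exact Continuous.intervalIntegrable (by fun_prop) _ _
  · exact ((continuous_inv_sqrt_one_sub_mul_sin_sq hm).const_mul _).intervalIntegrable _ _

theorem hasDerivAt_ellipticB {m : ℝ} (hm : m < 1) :
    HasDerivAt ellipticB (∫ θ in (0 : ℝ)..(Real.pi / 2),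
      Real.cos θ ^ 2 * Real.sin θ ^ 2 / (2 * √(1 - m * Real.sin θ ^ 2) ^ 3)) m := by
  refine intervalIntegral.hasDerivAt_integral_of_continuousOn
    (F := fun m θ => Real.cos θ ^ 2 / √(1 - m * Real.sin θ ^ 2))
    (F' := fun m θ => Real.cos θ ^ 2 * Real.sin θ ^ 2 / (2 * √(1 - m * Real.sin θ ^ 2) ^ 3))
    isOpen_Iio (Set.mem_Iio.2 hm) _ _ (fun x hx => ?_) (fun x hx θ => ?_) ?_
  · exact Continuous.div (by fun_prop) (by fun_prop) fun θ =>
      (Real.sqrt_pos.2 (one_sub_mul_sin_sq_pos hx θ)).ne'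
  · have hpos := one_sub_mul_sin_sq_pos hx θ
    have hs := Real.sqrt_pos.2 hpos
    have h1 : HasDerivAt (fun x => 1 - x * Real.sin θ ^ 2) (-Real.sin θ ^ 2) x := by
      simpa using ((hasDerivAt_id x).mul_const (Real.sin θ ^ 2)).const_sub 1
    refine (((h1.sqrt hpos.ne').fun_inv hs.ne').const_mul (Real.cos θ ^ 2)).congr_deriv ?_
    field_simp
  · refine ContinuousOn.div (by fun_prop) (by fun_prop) fun p hp => ?_
    have hs := Real.sqrt_pos.2 (one_sub_mul_sin_sq_pos hp.1 p.2)
    positivity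

/-- This function vanishes at `0` and `π/2`, so its derivative integrates to zero, which is the
relation between `B`, `B'` and `K`. -/
theorem hasDerivAt_sin_mul_cos_div {m : ℝ} (hm : m < 1) (θ : ℝ) :
    HasDerivAt (fun θ => Real.sin θ * Real.cos θ / √(1 - m * Real.sin θ ^ 2))
      ((2 * Real.cos θ ^ 2 - 1) / √(1 - m * Real.sin θ ^ 2) +
        m * Real.sin θ ^ 2 * Real.cos θ ^ 2 / √(1 - m * Real.sin θ ^ 2) ^ 3) θ := by
  have hpos := one_sub_mul_sin_sq_pos hm θ
  have hs := Real.sqrt_pos.2 hpos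
  have h1 : HasDerivAt (fun x => 1 - m * Real.sin x ^ 2)
      (-(m * (2 * Real.sin θ * Real.cos θ))) θ := by
    simpa using (((Real.hasDerivAt_sin θ).fun_pow 2).const_mul m).const_sub 1
  refine (((Real.hasDerivAt_sin θ).fun_mul (Real.hasDerivAt_cos θ)).fun_div
    (h1.sqrt hpos.ne') hs.ne').congr_deriv ?_
  have h := Real.sin_sq_add_cos_sq θ
  have h' : Real.sin θ ^ 2 = 1 - Real.cos θ ^ 2 := by linarith
  field_simp
  rw [h']
  ring

/-- The differential equation satisfied by `ellipticB`. -/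
theorem two_mul_ellipticB_add {m : ℝ} (hm : m < 1) :
    2 * ellipticB m + 2 * m * (∫ θ in (0 : ℝ)..(Real.pi / 2),
      Real.cos θ ^ 2 * Real.sin θ ^ 2 / (2 * √(1 - m * Real.sin θ ^ 2) ^ 3)) = ellipticK m := by
  have hs : ∀ θ, 0 < √(1 - m * Real.sin θ ^ 2) := fun θ =>
    Real.sqrt_pos.2 (one_sub_mul_sin_sq_pos hm θ)
  have c1 : Continuous fun θ => Real.cos θ ^ 2 / √(1 - m * Real.sin θ ^ 2) :=
    Continuous.div (by fun_prop) (by fun_prop) fun θ => (hs θ).ne'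
  have c2 : Continuous fun θ =>
      Real.cos θ ^ 2 * Real.sin θ ^ 2 / (2 * √(1 - m * Real.sin θ ^ 2) ^ 3) :=
    Continuous.div (by fun_prop) (by fun_prop) fun θ => by have := hs θ; positivity
  have c3 := continuous_inv_sqrt_one_sub_mul_sin_sq hm
  have heq : ∀ θ, (2 * Real.cos θ ^ 2 - 1) / √(1 - m * Real.sin θ ^ 2) +
      m * Real.sin θ ^ 2 * Real.cos θ ^ 2 / √(1 - m * Real.sin θ ^ 2) ^ 3 =
      2 * (Real.cos θ ^ 2 / √(1 - m * Real.sin θ ^ 2)) + 2 * m *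
        (Real.cos θ ^ 2 * Real.sin θ ^ 2 / (2 * √(1 - m * Real.sin θ ^ 2) ^ 3)) -
        1 / √(1 - m * Real.sin θ ^ 2) := fun θ => by
    have := hs θ
    field_simp
    ring
  have i1 := (c1.const_mul 2).intervalIntegrable (μ := volume) 0 (Real.pi / 2)
  have i2 := (c2.const_mul (2 * m)).intervalIntegrable (μ := volume) 0 (Real.pi / 2)
  have i3 := c3.intervalIntegrable (μ := volume) 0 (Real.pi / 2)
  have hFTC := intervalIntegral.integral_eq_sub_of_hasDerivAt (a := 0) (b := Real.pi / 2)
    (fun θ _ => hasDerivAt_sin_mul_cos_div hm θ) (by simp_rw [heq]; exact (i1.add i2).sub i3)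
  simp_rw [heq] at hFTC
  rw [intervalIntegral.integral_sub (i1.add i2) i3, intervalIntegral.integral_add i1 i2,
    intervalIntegral.integral_const_mul, intervalIntegral.integral_const_mul] at hFTC
  simp only [Real.cos_pi_div_two, Real.sin_zero, mul_zero, zero_mul, zero_div, sub_zero] at hFTC
  rw [ellipticB, ellipticK]
  linarith

/-! ### Closed forms and derivative of the area -/

/-- The area of the region where the product of the distances to the foci is at most `γ`, as an
integral. -/
noncomputable def cassiniArea (d γ : ℝ) : ℝ :=
  2 * ∫ φ in (0 : ℝ)..(Real.pi / 2), √(γ ^ 2 - d ^ 4 * Real.sin φ ^ 2)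

theorem continuous_cassiniArea (d : ℝ) : Continuous (cassiniArea d) := by
  unfold cassiniArea
  exact continuous_const.mul
    (intervalIntegral.continuous_parametric_intervalIntegral_of_continuous' (by fun_prop) _ _)

theorem cassiniArea_zero (d : ℝ) : cassiniArea d 0 = 0 := by
  have : ∀ φ, √((0 : ℝ) ^ 2 - d ^ 4 * Real.sin φ ^ 2) = 0 := fun φ =>
    Real.sqrt_eq_zero_of_nonpos (by have : 0 ≤ d ^ 4 * Real.sin φ ^ 2 := by positivity
                                    linarith)
  simp only [cassiniArea, this, intervalIntegral.integral_zero, mul_zero]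

theorem cassiniArea_of_pos (d : ℝ) {γ : ℝ} (hγ : 0 < γ) :
    cassiniArea d γ = 2 * γ * ellipticE (d ^ 4 / γ ^ 2) := by
  rw [cassiniArea, ellipticE, mul_assoc, ← intervalIntegral.integral_const_mul γ]
  congr 2 with φ
  rw [← Real.sqrt_sq hγ.le, ← Real.sqrt_mul (sq_nonneg _), Real.sqrt_sq hγ.le]
  congr 1
  field_simp

theorem hasDerivAt_cassiniArea_of_sq_lt {d γ : ℝ} (hγ : d ^ 2 < γ) :
    HasDerivAt (cassiniArea d) (2 * ellipticK (d ^ 4 / γ ^ 2)) γ := by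
  have hpos : ∀ x ∈ Set.Ioi (d ^ 2), ∀ φ, 0 < x ^ 2 - d ^ 4 * Real.sin φ ^ 2 := by
    intro x (hx : d ^ 2 < x) φ
    have h1 := Real.sin_sq_le_one φ
    have h2 : d ^ 4 * Real.sin φ ^ 2 ≤ d ^ 4 := mul_le_of_le_one_right (by positivity) h1
    nlinarith [sq_nonneg d]
  have h0 : 0 < γ := (sq_nonneg d).trans_lt hγ
  have key := (intervalIntegral.hasDerivAt_integral_of_continuousOn
    (F := fun x φ => √(x ^ 2 - d ^ 4 * Real.sin φ ^ 2))
    (F' := fun x φ => x / √(x ^ 2 - d ^ 4 * Real.sin φ ^ 2))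
    isOpen_Ioi (Set.mem_Ioi.2 hγ) 0 (Real.pi / 2) (fun x _ => by fun_prop) (fun x hx φ => ?_)
    ?_).const_mul 2
  · refine key.congr_deriv ?_
    rw [ellipticK]
    congr 2 with φ
    have h := Real.sqrt_pos.2 (hpos γ hγ φ)
    have e : 1 - d ^ 4 / γ ^ 2 * Real.sin φ ^ 2 = (γ ^ 2 - d ^ 4 * Real.sin φ ^ 2) / γ ^ 2 := by
      field_simp
    rw [e, Real.sqrt_div' _ (sq_nonneg _), Real.sqrt_sq h0.le]
    field_simp
  · have h1 : HasDerivAt (fun x => x ^ 2 - d ^ 4 * Real.sin φ ^ 2) (2 * x) x := by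
      simpa using (hasDerivAt_pow 2 x).sub_const (d ^ 4 * Real.sin φ ^ 2)
    refine (h1.sqrt (hpos x hx φ).ne').congr_deriv ?_
    rw [mul_div_mul_left _ _ two_ne_zero]
  · exact ContinuousOn.div (by fun_prop) (by fun_prop) fun p hp =>
      (Real.sqrt_pos.2 (hpos p.1 hp.1 p.2)).ne'

/-- The substitution `sin φ = k sin θ`. -/
theorem integral_sqrt_sq_sub_sin_sq {k : ℝ} (hk₀ : 0 ≤ k) (hk₁ : k < 1) :
    ∫ φ in (0 : ℝ)..(Real.pi / 2), √(k ^ 2 - Real.sin φ ^ 2) = k ^ 2 * ellipticB (k ^ 2) := by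
  have hc : Continuous fun φ => √(k ^ 2 - Real.sin φ ^ 2) := by fun_prop
  have hm : k ^ 2 < 1 := by nlinarith
  -- Past `arcsin k` the radicand is nonpositive and `√` returns 0.
  have hzero : ∫ φ in (Real.arcsin k)..(Real.pi / 2), √(k ^ 2 - Real.sin φ ^ 2) = 0 := by
    rw [intervalIntegral.integral_congr (g := fun _ => 0)]
    · simp
    · intro φ hφ
      rw [Set.uIcc_of_le (Real.arcsin_le_pi_div_two k)] at hφ
      have h1 : k ≤ Real.sin φ := (Real.arcsin_le_iff_le_sin ⟨by linarith, hk₁.le⟩ ⟨by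
        linarith [hφ.1, Real.arcsin_nonneg.2 hk₀, Real.pi_pos], hφ.2⟩).1 hφ.1
      exact Real.sqrt_eq_zero_of_nonpos (by nlinarith)
  have hlt : ∀ θ, (k * Real.sin θ) ^ 2 < 1 := fun θ => by
    have := one_sub_mul_sin_sq_pos hm θ
    rw [mul_pow]; linarith
  have habs : ∀ θ, -1 < k * Real.sin θ ∧ k * Real.sin θ < 1 := fun θ =>
    abs_lt.1 ((sq_lt_one_iff_abs_lt_one _).1 (hlt θ))
  have hderiv : ∀ θ, HasDerivAt (fun θ => Real.arcsin (k * Real.sin θ))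
      (1 / √(1 - (k * Real.sin θ) ^ 2) * (k * Real.cos θ)) θ := fun θ =>
    HasDerivAt.comp (h₂ := Real.arcsin) (h := fun θ => k * Real.sin θ) θ
      (Real.hasDerivAt_arcsin (habs θ).1.ne' (habs θ).2.ne) ((Real.hasDerivAt_sin θ).const_mul k)
  have hcd : Continuous fun θ => 1 / √(1 - (k * Real.sin θ) ^ 2) * (k * Real.cos θ) :=
    (continuous_const.div (by fun_prop) fun θ =>
      (Real.sqrt_pos.2 (sub_pos.2 (hlt θ))).ne').mul (by fun_prop)
  have hsub := intervalIntegral.integral_comp_mul_deriv (a := 0) (b := Real.pi / 2)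
    (fun θ _ => hderiv θ) hcd.continuousOn hc
  rw [← intervalIntegral.integral_add_adjacent_intervals (b := Real.arcsin k)
    (hc.intervalIntegrable _ _) (hc.intervalIntegrable _ _), hzero, add_zero]
  simp only [Real.sin_zero, mul_zero, Real.arcsin_zero, Real.sin_pi_div_two, mul_one] at hsub
  rw [← hsub, ellipticB, ← intervalIntegral.integral_const_mul]
  refine intervalIntegral.integral_congr fun θ hθ => ?_
  rw [Set.uIcc_of_le (by positivity)] at hθ
  have hcos : 0 ≤ Real.cos θ := Real.cos_nonneg_of_mem_Icc ⟨by linarith [hθ.1, Real.pi_pos], hθ.2⟩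
  have e : k ^ 2 - (k * Real.sin θ) ^ 2 = (k * Real.cos θ) ^ 2 := by
    rw [mul_pow, mul_pow, Real.cos_sq']; ring
  simp only [Function.comp_apply]
  rw [Real.sin_arcsin (habs θ).1.le (habs θ).2.le, e, Real.sqrt_sq (by positivity), mul_pow k]
  ring

theorem cassiniArea_of_lt_sq {d γ : ℝ} (hγ₀ : 0 ≤ γ) (hγ₁ : γ < d ^ 2) :
    cassiniArea d γ = 2 / d ^ 2 * (γ ^ 2 * ellipticB (γ ^ 2 / d ^ 4)) := by
  have hd : 0 < d ^ 2 := hγ₀.trans_lt hγ₁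
  have hd' : d ≠ 0 := by rintro rfl; simp at hd
  have h := integral_sqrt_sq_sub_sin_sq (k := γ / d ^ 2) (by positivity) ((div_lt_one hd).2 hγ₁)
  have e : (γ / d ^ 2) ^ 2 = γ ^ 2 / d ^ 4 := by rw [div_pow, ← pow_mul]
  have e' : ∀ φ, √(γ ^ 2 - d ^ 4 * Real.sin φ ^ 2) =
      d ^ 2 * √((γ / d ^ 2) ^ 2 - Real.sin φ ^ 2) := fun φ => by
    rw [← Real.sqrt_sq hd.le, ← Real.sqrt_mul (sq_nonneg _), Real.sqrt_sq hd.le]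
    congr 1
    field_simp
  simp_rw [cassiniArea, e', intervalIntegral.integral_const_mul, h, e]
  field_simp

theorem sq_div_pow_four_lt_one {d γ : ℝ} (hγ : |γ| < d ^ 2) : γ ^ 2 / d ^ 4 < 1 := by
  have hd : 0 < d ^ 2 := (abs_nonneg γ).trans_lt hγ
  have h : γ ^ 2 < d ^ 4 := by
    rw [show d ^ 4 = (d ^ 2) ^ 2 by ring]
    exact sq_lt_sq' (abs_lt.1 hγ).1 (abs_lt.1 hγ).2
  exact (div_lt_one ((sq_nonneg γ).trans_lt h)).2 h

theorem cassiniArea_eq_of_lt_sq {d γ : ℝ} (hγ₀ : 0 ≤ γ) (hγ₁ : γ < d ^ 2) :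
    cassiniArea d γ = 2 / d ^ 2 *
      (d ^ 4 * ellipticE (γ ^ 2 / d ^ 4) + (γ ^ 2 - d ^ 4) * ellipticK (γ ^ 2 / d ^ 4)) := by
  have hd' : d ≠ 0 := by rintro rfl; simp at hγ₁; linarith
  have h := mul_ellipticB (sq_div_pow_four_lt_one (abs_lt.2 ⟨by linarith, hγ₁⟩))
  rw [cassiniArea_of_lt_sq hγ₀ hγ₁]
  congr 1
  have h2 : d ^ 4 * _ = d ^ 4 * _ := congrArg (d ^ 4 * ·) h
  rw [show d ^ 4 * (γ ^ 2 / d ^ 4 * ellipticB (γ ^ 2 / d ^ 4)) =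
    γ ^ 2 * ellipticB (γ ^ 2 / d ^ 4) by field_simp] at h2
  rw [h2]
  field_simp
  ring

/-- Using `ellipticB` avoids differentiating `E` and `K` separately. The range is two-sided so that
it includes `γ = 0`. -/
theorem hasDerivAt_sq_mul_ellipticB {d γ : ℝ} (hγ : |γ| < d ^ 2) :
    HasDerivAt (fun γ => 2 / d ^ 2 * (γ ^ 2 * ellipticB (γ ^ 2 / d ^ 4)))
      (2 * γ / d ^ 2 * ellipticK (γ ^ 2 / d ^ 4)) γ := by
  have hm := sq_div_pow_four_lt_one hγ
  have hd' : d ≠ 0 := by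
    rintro rfl
    simp at hγ
    linarith [abs_nonneg γ]
  have h1 : HasDerivAt (fun γ : ℝ => γ ^ 2) (2 * γ) γ := by simpa using hasDerivAt_pow 2 γ
  have h2 := (hasDerivAt_ellipticB hm).comp γ (h1.div_const (d ^ 4))
  refine ((h1.fun_mul h2).const_mul (2 / d ^ 2)).congr_deriv ?_
  rw [← two_mul_ellipticB_add hm]
  simp only [Function.comp_apply]
  field_simp

theorem volume_real_setOf_distProduct_le_eq_cassiniArea (d γ : ℝ) :
    volume.real {x : Plane | distProduct d x ≤ γ} = cassiniArea d (max γ 0) := by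
  rcases lt_or_ge γ 0 with hγ | hγ
  · have h : {x : Plane | distProduct d x ≤ γ} = ∅ := by
      ext x
      simpa using hγ.trans_le (distProduct_nonneg d x)
    rw [h, max_eq_right hγ.le, cassiniArea_zero, measureReal_empty]
  · rw [max_eq_left hγ, volume_real_setOf_distProduct_le d hγ, cassiniArea]

/-- The derivative of the area of the Cassini oval, for `γ ≠ d ^ 2`. -/
noncomputable def cassiniAreaDeriv (d γ : ℝ) : ℝ :=
  if γ < 0 then 0
  else if γ < d ^ 2 then 2 * γ / d ^ 2 * ellipticK (γ ^ 2 / d ^ 4)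
  else 2 * ellipticK (d ^ 4 / γ ^ 2)

theorem hasDerivAt_cassiniArea_max {d : ℝ} (hd : 0 < d) {γ : ℝ} (hγ : γ ≠ d ^ 2) :
    HasDerivAt (fun γ => cassiniArea d (max γ 0)) (cassiniAreaDeriv d γ) γ := by
  have hd2 : 0 < d ^ 2 := by positivity
  rcases lt_trichotomy γ 0 with h | rfl | h
  · rw [cassiniAreaDeriv, if_pos h]
    refine (hasDerivAt_const γ (cassiniArea d 0)).congr_of_eventuallyEq ?_
    filter_upwards [eventually_lt_nhds h] with x hx
    rw [max_eq_right hx.le]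
  · have h0 : cassiniAreaDeriv d 0 = 0 := by simp [cassiniAreaDeriv, hd2]
    -- The formulas on the two sides of 0 differ, but both one-sided derivatives vanish there.
    rw [h0, ← hasDerivWithinAt_univ, ← Set.Iic_union_Ici (a := (0 : ℝ))]
    refine HasDerivWithinAt.union ?_ ?_
    · refine (hasDerivWithinAt_const 0 _ (cassiniArea d 0)).congr (fun x hx => ?_) (by simp)
      rw [max_eq_right hx]
    · have hB := (hasDerivAt_sq_mul_ellipticB (d := d) (γ := 0) (by simpa using hd2)).hasDerivWithinAt
        (s := Set.Ici 0)
      simp only [mul_zero, zero_div, zero_mul] at hB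
      refine hB.congr_of_eventuallyEq_of_mem ?_ Set.self_mem_Ici
      filter_upwards [self_mem_nhdsWithin, mem_nhdsWithin_of_mem_nhds (eventually_lt_nhds hd2)]
        with x (hx : 0 ≤ x) hx'
      rw [max_eq_left hx, cassiniArea_of_lt_sq hx hx']
  · rcases hγ.lt_or_gt with h' | h'
    · rw [cassiniAreaDeriv, if_neg h.not_gt, if_pos h']
      refine (hasDerivAt_sq_mul_ellipticB (by rwa [abs_of_pos h])).congr_of_eventuallyEq ?_
      filter_upwards [eventually_gt_nhds h, eventually_lt_nhds h'] with x hx hx'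
      rw [max_eq_left hx.le, cassiniArea_of_lt_sq hx.le hx']
    · rw [cassiniAreaDeriv, if_neg h.not_gt, if_neg h'.not_gt]
      refine (hasDerivAt_cassiniArea_of_sq_lt h').congr_of_eventuallyEq ?_
      filter_upwards [eventually_gt_nhds h] with x hx
      rw [max_eq_left hx.le]

/-! ### Distribution function, density and conclusion -/

theorem optCDF_eq (lam : ℝ) {d : ℝ} (hd : 0 < d) (γ : ℝ) :
    optCDF lam d γ = 1 - Real.exp (-(lam * cassiniArea d (max γ 0))) := by
  unfold optCDF
  split_ifs with h1 h2
  · simp [max_eq_right h1.le, cassiniArea_zero]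
  · rw [not_lt] at h1
    rw [max_eq_left h1, cassiniArea_eq_of_lt_sq h1 h2]
    congr 2
    ring
  · rw [not_lt] at h1 h2
    rw [max_eq_left h1, cassiniArea_of_pos d ((by positivity : 0 < d ^ 2).trans_le h2)]
    congr 2
    ring

theorem optPDF_eq (lam : ℝ) {d : ℝ} (hd : 0 < d) (γ : ℝ) :
    optPDF lam d γ =
      lam * cassiniAreaDeriv d γ * Real.exp (-(lam * cassiniArea d (max γ 0))) := by
  unfold optPDF cassiniAreaDeriv
  split_ifs with h1 h2
  · simp
  · rw [not_lt] at h1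
    rw [max_eq_left h1, cassiniArea_eq_of_lt_sq h1 h2,
      show ∀ y, -(2 * lam / d ^ 2) * y = -(lam * (2 / d ^ 2 * y)) from fun y => by ring]
    ring
  · rw [not_lt] at h1 h2
    rw [max_eq_left h1, cassiniArea_of_pos d ((by positivity : 0 < d ^ 2).trans_le h2),
      show ∀ y, 2 * lam * γ * y = lam * (2 * γ * y) from fun y => by ring]
    ring

theorem hasDerivAt_optCDF (lam : ℝ) {d : ℝ} (hd : 0 < d) {γ : ℝ} (hγ : γ ≠ d ^ 2) :
    HasDerivAt (optCDF lam d) (optPDF lam d γ) γ := by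
  rw [funext (optCDF_eq lam hd), optPDF_eq lam hd]
  refine ((((hasDerivAt_cassiniArea_max hd hγ).const_mul lam).fun_neg.exp).const_sub 1).congr_deriv ?_
  ring

theorem continuous_optCDF (lam : ℝ) {d : ℝ} (hd : 0 < d) : Continuous (optCDF lam d) := by
  rw [funext (optCDF_eq lam hd)]
  have := continuous_cassiniArea d
  fun_prop

theorem theorem1 {Ω : Type*} [MeasurableSpace Ω] (P : Measure Ω) [IsProbabilityMeasure P]
    (Φ : Ω → Set Plane) (lam : ℝ≥0) (hlam : 0 < lam) (hΦ : IsPoissonProcess P Φ lam)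
    (d : ℝ) (hd : 0 < d) :
    -- the minimum over the points of the process is almost surely attained
    (∀ᵐ ω ∂P, IsLeast (distProduct d '' Φ ω) (minDistProduct d (Φ ω))) ∧
    -- it is a random variable
    Measurable (fun ω => minDistProduct d (Φ ω)) ∧
    -- its CDF, through the area of the Cassini oval and through elliptic integrals
    (∀ γ : ℝ, cdf (P.map (fun ω => minDistProduct d (Φ ω))) γ
      = 1 - Real.exp (-(lam * volume.real {x : Plane | distProduct d x ≤ γ}))) ∧
    (∀ γ : ℝ, cdf (P.map (fun ω => minDistProduct d (Φ ω))) γ = optCDF lam d γ) ∧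
    -- its PDF, as the density of the law and as the derivative of the CDF
    P.map (fun ω => minDistProduct d (Φ ω))
      = volume.withDensity (fun γ => ENNReal.ofReal (optPDF lam d γ)) ∧
    (∀ γ : ℝ, γ ≠ d ^ 2 →
      HasDerivAt (cdf (P.map (fun ω => minDistProduct d (Φ ω)))) (optPDF lam d γ) γ) := by
  have hm := hΦ.measurable_minDistProduct d
  have := Measure.isProbabilityMeasure_map (μ := P) hm.aemeasurable
  have hcdf := hΦ.cdf_map_minDistProduct hlam d
  have hopt : ∀ γ, cdf (P.map (fun ω => minDistProduct d (Φ ω))) γ = optCDF lam d γ := fun γ => by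
    rw [hcdf, optCDF_eq _ hd, volume_real_setOf_distProduct_le_eq_cassiniArea]
  have hderiv : ∀ γ : ℝ, γ ≠ d ^ 2 →
      HasDerivAt (cdf (P.map (fun ω => minDistProduct d (Φ ω)))) (optPDF lam d γ) γ :=
    fun γ hγ => by
      rw [funext hopt]
      exact hasDerivAt_optCDF lam hd hγ
  refine ⟨?_, hm, hcdf, hopt, ?_, hderiv⟩
  · filter_upwards [hΦ.ae_nonempty hlam] with ω hω
    exact isLeast_minDistProduct d hω (hΦ.locallyFinite ω)
  · conv_lhs => rw [← measure_cdf (P.map (fun ω => minDistProduct d (Φ ω)))]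
    refine StieltjesFunction.measure_eq_withDensity_of_hasDerivAt _ ?_ hderiv
    rw [funext hopt]
    exact continuous_optCDF lam hd
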